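/- For a finite connected simplicial graph $\Gamma$ let $A(\Gamma)=\langle V(\Gamma)\mid uv=vu \text{ for every edge } \{u,v\}\rangle$ be its right-angled Artin group, and write $x^g=g^{-1}xg$. The syllable length of $g\in A(\Gamma)$ is the least $n$ such that $g$ is a product of $n$ nonzero powers of vertices. The extension graph $\Gamma^e$ is the simplicial graph whose vertices are the elements $v^g$ of $A(\Gamma)$ with $v\in V(\Gamma)$, $g\in A(\Gamma)$, two distinct vertices being adjacent if and only if they commute; $A(\Gamma)$ acts on it by $x\mapsto x^g$. With the edge metric $d$ of $\Gamma^e$, the asymptotic translation length of $g$ is $\tau(g)=\lim_{n\to\infty} d(x,x^{g^n})/n$, for any vertex $x$ of $\Gamma^e$. For an integer $k\ge 2$ let $\Gamma_k$ be the following graph. Take three disjoint stars with centers $u,v,t$ and leaves $u_1,\dots,u_k$, $v_1,\dots,v_k$, $t_1,\dots,t_k$, respectively. Add the edges $u_iv_i$ and $v_it_i$ for $1\le i\le k$ and the edges $t_iu_{i+1}$ for $1\le i\le k-1$, and join $t_k$ to $u_1$ by a path of length $2$ through one new vertex $w$. Then for every integer $k\ge 2$ the graph $\Gamma_k$ is finite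 and connected, the element $g=tvu$ of $A(\Gamma_k)$ has syllable length $3$, the graph $\Gamma_k^e$ is connected, and for every vertex $x$ of $\Gamma_k^e$ the limit $\lim_{n\to\infty} d(x,x^{g^n})/n$ exists and equals $3+\frac1k$. In particular the asymptotic translation length of $g$ on $\Gamma_k^e$ is a rational number whose denominator in lowest terms is $k$. -/

import Mathlib

open Filter Topology

namespace RAAG

section General

variable {V : Type*}

/-- The right-angled Artin group of a graph: one generator for each vertex, and the relation
that `u` and `v` commute for each edge `{u, v}`. -/
abbrev ArtinGroup (Γ : SimpleGraph V) : Type _ :=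
  PresentedGroup {r : FreeGroup V | ∃ u v : V, Γ.Adj u v ∧
    r = FreeGroup.of u * FreeGroup.of v * (FreeGroup.of u)⁻¹ * (FreeGroup.of v)⁻¹}

/-- The generator of the right-angled Artin group given by a vertex. -/
def gen (Γ : SimpleGraph V) (v : V) : ArtinGroup Γ := PresentedGroup.of v

/-- A syllable is a nonzero power of a vertex. -/
def IsSyllable (Γ : SimpleGraph V) (s : ArtinGroup Γ) : Prop :=
  ∃ (v : V) (m : ℤ), m ≠ 0 ∧ s = gen Γ v ^ m

/-- The least number of syllables whose product is `g`. -/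
noncomputable def syllableLength (Γ : SimpleGraph V) (g : ArtinGroup Γ) : ℕ :=
  sInf {n : ℕ | ∃ l : List (ArtinGroup Γ), (∀ s ∈ l, IsSyllable Γ s) ∧ l.length = n ∧ l.prod = g}

/-- The vertices of the extension graph: the elements `v ^ g = g⁻¹ v g` of the right-angled
Artin group, for a vertex `v` and a group element `g`. -/
def ExtVertex (Γ : SimpleGraph V) : Type _ :=
  {x : ArtinGroup Γ // ∃ (v : V) (g : ArtinGroup Γ), x = g⁻¹ * gen Γ v * g}

/-- The extension graph: two different vertices are adjacent when they commute. -/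
def extensionGraph (Γ : SimpleGraph V) : SimpleGraph (ExtVertex Γ) where
  Adj x y := x ≠ y ∧ Commute x.1 y.1
  symm := ⟨fun _ _ h => ⟨h.1.symm, h.2.symm⟩⟩
  loopless := ⟨fun _ h => h.1 rfl⟩

/-- The map `x ↦ x ^ g = g⁻¹ x g` on the vertices of the extension graph. -/
def conj (Γ : SimpleGraph V) (g : ArtinGroup Γ) (x : ExtVertex Γ) : ExtVertex Γ :=
  ⟨g⁻¹ * x.1 * g, by
    obtain ⟨v, h, hx⟩ := x.2
    exact ⟨v, h * g, by rw [hx]; group⟩⟩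

theorem conj_one (Γ : SimpleGraph V) (x : ExtVertex Γ) : conj Γ 1 x = x := by
  apply Subtype.ext
  simp [conj]

theorem conj_conj (Γ : SimpleGraph V) (g h : ArtinGroup Γ) (x : ExtVertex Γ) :
    conj Γ h (conj Γ g x) = conj Γ (g * h) x := by
  apply Subtype.ext
  simp [conj, mul_assoc]

theorem commute_conj (Γ : SimpleGraph V) (g : ArtinGroup Γ) (x y : ExtVertex Γ) :
    Commute (conj Γ g x).1 (conj Γ g y).1 ↔ Commute x.1 y.1 := by
  simp only [conj, commute_iff_eq, mul_assoc, mul_inv_cancel_left, mul_right_inj]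
  simp only [← mul_assoc, mul_left_inj]

/-- The automorphism `x ↦ x ^ g` of the extension graph. These automorphisms form the right action
of the right-angled Artin group on its extension graph. -/
def conjIso (Γ : SimpleGraph V) (g : ArtinGroup Γ) : extensionGraph Γ ≃g extensionGraph Γ where
  toFun := conj Γ g
  invFun := conj Γ g⁻¹
  left_inv x := by rw [conj_conj, mul_inv_cancel, conj_one]
  right_inv x := by rw [conj_conj, inv_mul_cancel, conj_one]
  map_rel_iff' := by
    intro x y
    have hinj : Function.Injective (conj Γ g) := fun a b h => by
      have h2 := congrArg (conj Γ g⁻¹) h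
      simpa [conj_conj, conj_one] using h2
    exact and_congr hinj.ne_iff (commute_conj Γ g x y)

/-- `τ` is the asymptotic translation length of `g` on the extension graph with its edge metric:
`d (x, x ^ (g ^ n)) / n` tends to `τ` for every vertex `x`. -/
def HasTranslationLength (Γ : SimpleGraph V) (g : ArtinGroup Γ) (τ : ℝ) : Prop :=
  ∀ x : ExtVertex Γ,
    Tendsto (fun n : ℕ => ((extensionGraph Γ).dist x (conjIso Γ (g ^ n) x) : ℝ) / (n : ℝ))
      atTop (𝓝 τ)

end General

/-- Vertices of the graph `Γ_k`. The leaves numbered `1, …, k` of each star are indexed here by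
`0, …, k - 1`; `w` is the inner vertex of the path of length two from the last leaf at `t` to the
first leaf at `u`. -/
inductive GVertex (k : ℕ) : Type
  | u : GVertex k
  | v : GVertex k
  | t : GVertex k
  | uLeaf : Fin k → GVertex k
  | vLeaf : Fin k → GVertex k
  | tLeaf : Fin k → GVertex k
  | w : GVertex k

/-- The edges of `Γ_k`, each listed in one direction. -/
inductive GEdge (k : ℕ) : GVertex k → GVertex k → Prop
  | u_leaf (i : Fin k) : GEdge k GVertex.u (GVertex.uLeaf i)
  | v_leaf (i : Fin k) : GEdge k GVertex.v (GVertex.vLeaf i)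
  | t_leaf (i : Fin k) : GEdge k GVertex.t (GVertex.tLeaf i)
  | u_v (i : Fin k) : GEdge k (GVertex.uLeaf i) (GVertex.vLeaf i)
  | v_t (i : Fin k) : GEdge k (GVertex.vLeaf i) (GVertex.tLeaf i)
  | t_u (i j : Fin k) (h : (i : ℕ) + 1 = (j : ℕ)) : GEdge k (GVertex.tLeaf i) (GVertex.uLeaf j)
  | t_w (i : Fin k) (h : (i : ℕ) + 1 = k) : GEdge k (GVertex.tLeaf i) GVertex.w
  | w_u (i : Fin k) (h : (i : ℕ) = 0) : GEdge k GVertex.w (GVertex.uLeaf i)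

/-- The graph `Γ_k`. -/
def Gam (k : ℕ) : SimpleGraph (GVertex k) := SimpleGraph.fromRel (GEdge k)

/-- The element `t v u` of the right-angled Artin group of `Γ_k`. -/
def tvu (k : ℕ) : ArtinGroup (Gam k) :=
  gen (Gam k) GVertex.t * gen (Gam k) GVertex.v * gen (Gam k) GVertex.u

end RAAG

/-! Upper bound: a star center commutes with its leaves, so the conjugate of `uLeaf i` by `g` is
also its conjugate by `u * g`, and likewise at `v` and `t`. Hence the path `uLeaf i`, `vLeaf i`,
`tLeaf i` advances the conjugator by `tvu` at the cost of two edges. A third edge leads to `uLeaf (i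
+ 1)`; only after the last leaf is the detour through `w` needed, one extra edge in every `k`
periods. This gives `3 n + n / k` up to a constant (`exists_dist_uLeaf_le`).

Lower bound: `u`, `v`, `t` act on the integers by swaps under which `tvu` carries `3 n` to `3 n +
3`. Each vertex `x` of the graph gets an integer function `potential k x`, invariant under the swap
`κ x` and changing by at most one along edges. Evaluating it at `g · 0` assigns a number to the
conjugate of `x` by `g`, and it grows by `3 n + ⌈n / k⌉` along the orbit. That this number is
1-Lipschitz rests on `block_inter_of_commute`: commuting conjugates come from equal or adjacent
vertices and have intersecting blocks. Otherwise the action could be twisted by a finite fibre so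
that the two conjugates act on it without commuting. -/

namespace RAAG

/-! ### Star actions and twisted extensions detecting non-commutation -/

section TwistedAction

variable {V X : Type*} {Γ : SimpleGraph V}

/-- A homomorphism out of the right-angled Artin group, from images of the vertices which commute
along edges. -/
def lift {G : Type*} [Group G] (f : V → G) (hf : ∀ u v, Γ.Adj u v → Commute (f u) (f v)) :
    ArtinGroup Γ →* G :=
  PresentedGroup.toGroup (f := f) (by
    rintro _ ⟨u, v, huv, rfl⟩
    simp [(hf u v huv).eq])

@[simp]
theorem lift_gen {G : Type*} [Group G] (f : V → G)
    (hf : ∀ u v, Γ.Adj u v → Commute (f u) (f v)) (v : V) : lift f hf (gen Γ v) = f v :=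
  PresentedGroup.toGroup.of _

theorem commute_gen {u v : V} (h : Γ.Adj u v) : Commute (gen Γ u) (gen Γ v) := by
  have h1 : PresentedGroup.mk {r : FreeGroup V | ∃ u v : V, Γ.Adj u v ∧
      r = FreeGroup.of u * FreeGroup.of v * (FreeGroup.of u)⁻¹ * (FreeGroup.of v)⁻¹}
      (FreeGroup.of u * FreeGroup.of v * (FreeGroup.of u)⁻¹ * (FreeGroup.of v)⁻¹) = 1 :=
    PresentedGroup.one_of_mem ⟨u, v, h, rfl⟩
  have h2 : gen Γ u * gen Γ v * (gen Γ u)⁻¹ * (gen Γ v)⁻¹ = 1 := by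
    rwa [map_mul, map_mul, map_mul, map_inv, map_inv] at h1
  rw [commute_iff_eq]
  exact mul_inv_eq_iff_eq_mul.mp (mul_inv_eq_one.mp h2)

theorem gen_induction {p : ArtinGroup Γ → Prop} (one : p 1)
    (gen_mul : ∀ v g, p g → p (gen Γ v * g)) (inv_gen_mul : ∀ v g, p g → p ((gen Γ v)⁻¹ * g))
    (g : ArtinGroup Γ) : p g := by
  have hg : g ∈ Subgroup.closure (Set.range (gen Γ)) := by
    have := PresentedGroup.closure_range_of {r : FreeGroup V | ∃ u v : V, Γ.Adj u v ∧
      r = FreeGroup.of u * FreeGroup.of v * (FreeGroup.of u)⁻¹ * (FreeGroup.of v)⁻¹}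
    exact this ▸ Subgroup.mem_top g
  induction hg using Subgroup.closure_induction_left with
  | one => exact one
  | mul_left x hx y _ ih => obtain ⟨v, rfl⟩ := hx; exact gen_mul v y ih
  | inv_mul_cancel x hx y _ ih => obtain ⟨v, rfl⟩ := hx; exact inv_gen_mul v y ih

/-- An action `a` of the vertices on a set, together with an involution `κ v` for each vertex `v`
such that the vertices of the star of `v` act trivially or as `κ v`. -/
structure StarAction (Γ : SimpleGraph V) (X : Type*) where
  a : V → Equiv.Perm X
  κ : V → Equiv.Perm X
  κ_κ : ∀ v x, κ v (κ v x) = x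
  a_self : ∀ v, a v = 1 ∨ a v = κ v
  a_adj : ∀ u v, Γ.Adj u v → a v = 1 ∨ a v = κ u

namespace StarAction

variable (S : StarAction Γ X)

theorem commute_a {u v : V} (h : Γ.Adj u v) : Commute (S.a u) (S.a v) := by
  rcases S.a_adj u v h with h1 | h1
  · simp [h1]
  · rcases S.a_self u with h2 | h2
    · simp [h2]
    · rw [h1, h2]

/-- The action of the right-angled Artin group. -/
def hom : ArtinGroup Γ →* Equiv.Perm X := lift S.a fun _ _ h => S.commute_a h

/-- The orbit of `x` under the star of `v`. -/
def block (v : V) (x : X) : Set X := {y | y = x ∨ y = S.κ v x}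

theorem mem_block_κ {v : V} {x y : X} : S.κ v y ∈ S.block v x ↔ y ∈ S.block v x := by
  simp only [block, Set.mem_ofPred_eq]
  constructor
  · rintro (h | h)
    · right; rw [← h, S.κ_κ]
    · left; exact (S.κ v).injective h
  · rintro (h | h)
    · right; rw [h]
    · left; rw [h, S.κ_κ]

theorem mem_block_a_self {v : V} {x y : X} : S.a v y ∈ S.block v x ↔ y ∈ S.block v x := by
  rcases S.a_self v with h | h <;> simp [h, mem_block_κ]

theorem mem_block_a_adj {u v : V} (huv : Γ.Adj u v) {x y : X} :
    S.a v y ∈ S.block u x ↔ y ∈ S.block u x := by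
  rcases S.a_adj u v huv with h | h <;> simp [h, mem_block_κ]

theorem a_a (v : V) (x : X) : S.a v (S.a v x) = x := by
  rcases S.a_self v with h | h <;> simp [h, S.κ_κ]

theorem self_mem_block (v : V) (x : X) : x ∈ S.block v x := Or.inl rfl

variable {F : Type*}

/-- The action of a vertex on `X × F` which covers its action on `X` and acts on the fibres
through `c`. -/
def twist (c : V → X → Equiv.Perm F) (v : V) : Equiv.Perm (X × F) :=
  Equiv.prodShear (S.a v) (c v)

variable (c : V → X → Equiv.Perm F)

theorem twist_apply (v : V) (x : X) (y : F) : S.twist c v (x, y) = (S.a v x, c v x y) := rfl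

/-- By `hinv`, moving the base point by a neighbour does not change the fibre permutation, so both
orders of composition compare the same two fibre maps. -/
theorem commute_twist (hinv : ∀ u v, Γ.Adj u v → ∀ x, c u (S.a v x) = c u x)
    (hcomm : ∀ u v, Γ.Adj u v → ∀ x, Commute (c u x) (c v x)) (u v : V) (h : Γ.Adj u v) :
    Commute (S.twist c u) (S.twist c v) := by
  rw [commute_iff_eq]
  ext1 ⟨x, y⟩
  have h1 : S.a u (S.a v x) = S.a v (S.a u x) := DFunLike.congr_fun (S.commute_a h).eq x
  have h2 : c u x (c v x y) = c v x (c u x y) := DFunLike.congr_fun (hcomm u v h x).eq y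
  simp only [Equiv.Perm.mul_apply, twist_apply, hinv u v h, hinv v u h.symm, h1, h2]

theorem exists_lift_twist_eq (hc : ∀ u v, Γ.Adj u v → Commute (S.twist c u) (S.twist c v))
    (g : ArtinGroup Γ) (x : X) :
    ∃ p : Equiv.Perm F, ∀ y, lift (S.twist c) hc g (x, y) = (S.hom g x, p y) := by
  induction g using gen_induction with
  | one => exact ⟨1, fun y => by simp⟩
  | gen_mul v g ih =>
    obtain ⟨p, hp⟩ := ih
    refine ⟨c v (S.hom g x) * p, fun y => ?_⟩
    simp [hp, twist_apply, hom]
  | inv_gen_mul v g ih =>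
    obtain ⟨p, hp⟩ := ih
    refine ⟨(c v ((S.a v)⁻¹ (S.hom g x)))⁻¹ * p, fun y => ?_⟩
    rw [map_mul, Equiv.Perm.mul_apply, hp, map_inv, lift_gen, Equiv.Perm.inv_eq_iff_eq,
      twist_apply]
    simp [hom]

/-- A permutation whose square has a unique fixed point. -/
def rotThree : Equiv.Perm (Fin 4) := Equiv.swap 1 2 * Equiv.swap 2 3

theorem eq_zero_of_rotThree {y : Fin 4} (h : rotThree (rotThree y) = y) : y = 0 := by
  revert y; decide

theorem rotThree_zero : rotThree (rotThree 0) = 0 := by decide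

theorem finRotate_ne (y : Fin 4) : finRotate 4 (finRotate 4 y) ≠ y := by
  revert y; decide

/-- A permutation commuting with `α ^ 2` must preserve its only fixed point `y₀`, whereas a
conjugate of `β ^ 2` fixes nothing. -/
theorem false_of_commute (hc : ∀ u v, Γ.Adj u v → Commute (S.twist c u) (S.twist c v))
    {s s' : V} {q : ArtinGroup Γ} {x : X} {α β : Equiv.Perm F} {y₀ : F}
    (hα₀ : α (α y₀) = y₀) (hα : ∀ y, α (α y) = y → y = y₀) (hβ : ∀ y, β (β y) ≠ y)
    (hs : ∀ i ∈ S.block s x, c s i = α) (hs' : ∀ i ∈ S.block s' (S.hom q x), c s' i = β)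
    (h : Commute (gen Γ s) (q⁻¹ * gen Γ s' * q)) : False := by
  set T := lift (S.twist c) hc with hT
  have sq : ∀ (v : V) (x : X) (γ : Equiv.Perm F), (∀ i ∈ S.block v x, c v i = γ) →
      ∀ y, T (gen Γ v) (T (gen Γ v) (x, y)) = (x, γ (γ y)) := by
    intro v x γ hγ y
    rw [hT, lift_gen, twist_apply, twist_apply, S.a_a, hγ x (S.self_mem_block v x),
      hγ _ (S.mem_block_a_self.mpr (S.self_mem_block v x))]
  obtain ⟨p, hp⟩ := S.exists_lift_twist_eq c hc q x
  have hq : ∀ y, (T q)⁻¹ (S.hom q x, y) = (x, p⁻¹ y) := by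
    intro y
    rw [Equiv.Perm.inv_eq_iff_eq, hp, Equiv.Perm.inv_def, Equiv.apply_symm_apply]
  -- A vertex may move the base point, but its square does not, so the squares can be compared on
  -- the single fibre over `x`.
  have h2 := (h.map T).pow_pow 2 2
  have h3 := DFunLike.congr_fun h2.eq (x, y₀)
  have h4 : ∀ z, (T (q⁻¹ * gen Γ s' * q) ^ 2) z =
      (T q)⁻¹ (T (gen Γ s') (T (gen Γ s') (T q z))) := by
    intro z
    simp [pow_two]
  have h5 : ∀ z, (T (gen Γ s) ^ 2) z = T (gen Γ s) (T (gen Γ s) z) := by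
    intro z
    simp [pow_two]
  have h6 : ∀ y, (T (q⁻¹ * gen Γ s' * q) ^ 2) (x, y) = (x, p⁻¹ (β (β (p y)))) := by
    intro y
    rw [h4, hp, sq s' _ β hs', hq]
  rw [Equiv.Perm.mul_apply, Equiv.Perm.mul_apply, h6, h5, h5, sq s x α hs, sq s x α hs, h6,
    hα₀] at h3
  have h7 := hα _ (Prod.ext_iff.mp h3).2
  rw [Equiv.Perm.inv_eq_iff_eq] at h7
  exact hβ _ h7

open Classical in
/-- If conjugates of two vertices commute, the vertices are equal or adjacent and the blocks of
the two conjugates meet. -/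
theorem block_inter_of_commute {s s' : V} {q : ArtinGroup Γ} (x : X)
    (h : Commute (gen Γ s) (q⁻¹ * gen Γ s' * q)) :
    (s = s' ∨ Γ.Adj s s') ∧ ∃ i, i ∈ S.block s x ∧ i ∈ S.block s' (S.hom q x) := by
  by_contra hcon
  set B := S.block s x with hB
  set B' := S.block s' (S.hom q x) with hB'
  have hdis : ∀ i, i ∈ B → i ∈ B' → s ≠ s' ∧ ¬ Γ.Adj s s' := by
    intro i hi hi'
    rw [← not_or]
    exact fun h => hcon ⟨h, i, hi, hi'⟩
  -- Only `s` over `B` and `s'` over `B'` act on the fibre. Where both could act, `hdis` makes them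
  -- distinct and nonadjacent, so no relation is violated.
  let c : V → X → Equiv.Perm (Fin 4) := fun z i =>
    if z = s ∧ i ∈ B then rotThree else if z = s' ∧ i ∈ B' then finRotate 4 else 1
  have hinv : ∀ u v, Γ.Adj u v → ∀ i, c u (S.a v i) = c u i := by
    intro u v huv i
    have h1 : (u = s ∧ S.a v i ∈ B) ↔ (u = s ∧ i ∈ B) :=
      and_congr_right fun hu => S.mem_block_a_adj (hu ▸ huv)
    have h2 : (u = s' ∧ S.a v i ∈ B') ↔ (u = s' ∧ i ∈ B') :=
      and_congr_right fun hu => S.mem_block_a_adj (hu ▸ huv)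
    simp only [c, h1, h2]
  have hcomm : ∀ u v, Γ.Adj u v → ∀ i, Commute (c u i) (c v i) := by
    intro u v huv i
    simp only [c]
    split_ifs with h1 h2 h3 h4 h5 h6 h7
    any_goals simp
    · exact absurd (h1.1.symm ▸ h3.1.symm ▸ huv) (hdis i h1.2 h3.2).2
    · exact absurd (h4.1.symm ▸ h5.1.symm ▸ huv.symm) (hdis i h5.2 h4.2).2
  refine S.false_of_commute c (x := x) (S.commute_twist c hinv hcomm) rotThree_zero
    (fun y => eq_zero_of_rotThree) finRotate_ne (fun i hi => ?_) (fun i hi => ?_) h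
  · exact if_pos ⟨rfl, hi⟩
  · have h1 : ¬ (s' = s ∧ i ∈ B) := fun h => (hdis i h.2 hi).1 h.1.symm
    exact (if_neg h1).trans (if_pos ⟨rfl, hi⟩)

/-- A function which is invariant under the stars and varies by at most one along edges varies by
at most one on commuting conjugates of vertices. -/
theorem abs_sub_le_one {f : V → X → ℤ} (hκ : ∀ v x, f v (S.κ v x) = f v x)
    (hadj : ∀ u v, Γ.Adj u v → ∀ x, |f u x - f v x| ≤ 1) {s s' : V} {g g' : ArtinGroup Γ}
    (h : Commute (g⁻¹ * gen Γ s * g) (g'⁻¹ * gen Γ s' * g')) (x : X) :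
    |f s (S.hom g x) - f s' (S.hom g' x)| ≤ 1 := by
  have hblock : ∀ v y i, i ∈ S.block v y → f v i = f v y := by
    rintro v y i (rfl | rfl)
    · rfl
    · exact hκ v y
  -- Conjugation by `g` makes one element a generator and moves the base point to `S.hom g x`.
  have h' : Commute (gen Γ s) ((g' * g⁻¹)⁻¹ * gen Γ s' * (g' * g⁻¹)) := by
    have h1 := h.map (MulAut.conj g).toMonoidHom
    simpa [mul_assoc] using h1
  obtain ⟨hss, i, hi, hi'⟩ := S.block_inter_of_commute (S.hom g x) h'
  have h2 : S.hom (g' * g⁻¹) (S.hom g x) = S.hom g' x := by simp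
  rw [h2] at hi'
  rw [← hblock _ _ _ hi, ← hblock _ _ _ hi']
  rcases hss with rfl | hss
  · simp
  · exact hadj _ _ hss i

end StarAction

end TwistedAction

/-! ### Distances and translation lengths in the extension graph -/

section ExtensionGraph

variable {V : Type*} {Γ : SimpleGraph V}

/-- The vertex `v ^ g` of the extension graph. -/
def conjVertex (Γ : SimpleGraph V) (v : V) (g : ArtinGroup Γ) : ExtVertex Γ :=
  ⟨g⁻¹ * gen Γ v * g, v, g, rfl⟩

theorem exists_conjVertex_eq (x : ExtVertex Γ) : ∃ v g, conjVertex Γ v g = x := by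
  obtain ⟨v, g, h⟩ := x.2
  exact ⟨v, g, Subtype.ext h.symm⟩

theorem conjVertex_mul {v : V} {h : ArtinGroup Γ} (hv : Commute (gen Γ v) h) (g : ArtinGroup Γ) :
    conjVertex Γ v (h * g) = conjVertex Γ v g := by
  apply Subtype.ext
  have h1 : h⁻¹ * gen Γ v * h = gen Γ v := by rw [mul_assoc, hv.eq, inv_mul_cancel_left]
  calc (h * g)⁻¹ * gen Γ v * (h * g) = g⁻¹ * (h⁻¹ * gen Γ v * h) * g := by group
    _ = g⁻¹ * gen Γ v * g := by rw [h1]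

theorem conjIso_conjVertex (v : V) (g h : ArtinGroup Γ) :
    conjIso Γ h (conjVertex Γ v g) = conjVertex Γ v (g * h) := by
  apply Subtype.ext
  change h⁻¹ * (g⁻¹ * gen Γ v * g) * h = (g * h)⁻¹ * gen Γ v * (g * h)
  group

theorem commute_conjVertex {u v : V} (h : Γ.Adj u v) (g : ArtinGroup Γ) :
    Commute (conjVertex Γ u g).1 (conjVertex Γ v g).1 := by
  have h1 := (commute_gen h).map (MulAut.conj g⁻¹).toMonoidHom
  simpa [conjVertex] using h1

theorem eq_or_adj_of_commute {x y : ExtVertex Γ} (h : Commute x.1 y.1) :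
    x = y ∨ (extensionGraph Γ).Adj x y :=
  (eq_or_ne x y).imp_right fun hne => ⟨hne, h⟩

theorem reachable_of_commute {x y : ExtVertex Γ} (h : Commute x.1 y.1) :
    (extensionGraph Γ).Reachable x y := by
  rcases eq_or_adj_of_commute h with rfl | h
  · rfl
  · exact h.reachable

theorem dist_le_one_of_commute {x y : ExtVertex Γ} (h : Commute x.1 y.1) :
    (extensionGraph Γ).dist x y ≤ 1 := by
  rcases eq_or_adj_of_commute h with rfl | h
  · simp
  · exact (SimpleGraph.dist_eq_one_iff_adj.mpr h).le

theorem dist_conjVertex_le_one {u v : V} (h : Γ.Adj u v) (g : ArtinGroup Γ) :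
    (extensionGraph Γ).dist (conjVertex Γ u g) (conjVertex Γ v g) ≤ 1 :=
  dist_le_one_of_commute (commute_conjVertex h g)

theorem reachable_conjVertex {u v : V} (h : Γ.Reachable u v) (g : ArtinGroup Γ) :
    (extensionGraph Γ).Reachable (conjVertex Γ u g) (conjVertex Γ v g) := by
  obtain ⟨p⟩ := h
  induction p with
  | nil => rfl
  | cons h _ ih => exact (reachable_of_commute (commute_conjVertex h g)).trans ih

/-- The copies of `Γ` conjugated by `g` and by `gen Γ v * g` share the vertex coming from `v`, so
connected copies chain together along a word. -/
theorem extensionGraph_connected (hΓ : Γ.Connected) : (extensionGraph Γ).Connected := by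
  obtain ⟨v₀⟩ := hΓ.nonempty
  have key : ∀ g, (extensionGraph Γ).Reachable (conjVertex Γ v₀ g) (conjVertex Γ v₀ 1) := by
    intro g
    have step : ∀ v g (h : ArtinGroup Γ), Commute (gen Γ v) h →
        (extensionGraph Γ).Reachable (conjVertex Γ v₀ (h * g)) (conjVertex Γ v₀ g) := by
      intro v g h hv
      have h1 := reachable_conjVertex (hΓ.preconnected v₀ v) (h * g)
      rw [conjVertex_mul hv] at h1
      exact h1.trans (reachable_conjVertex (hΓ.preconnected v v₀) g)
    induction g using gen_induction with
    | one => rfl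
    | gen_mul v g ih => exact (step v g _ (Commute.refl _)).trans ih
    | inv_gen_mul v g ih => exact (step v g _ (Commute.refl _).inv_right).trans ih
  have : Nonempty (ExtVertex Γ) := ⟨conjVertex Γ v₀ 1⟩
  refine SimpleGraph.Connected.mk fun x y => ?_
  obtain ⟨u, g, rfl⟩ := exists_conjVertex_eq x
  obtain ⟨v, h, rfl⟩ := exists_conjVertex_eq y
  exact ((reachable_conjVertex (hΓ.preconnected u v₀) g).trans (key g)).trans
    ((reachable_conjVertex (hΓ.preconnected v v₀) h).trans (key h)).symm

theorem abs_sub_le_dist {W : Type*} {G : SimpleGraph W} (hG : G.Connected) {f : W → ℤ}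
    (hf : ∀ x y, G.Adj x y → |f x - f y| ≤ 1) (x y : W) : |f x - f y| ≤ G.dist x y := by
  obtain ⟨p, hp⟩ := hG.exists_walk_length_eq_dist x y
  rw [← hp]
  clear hp
  induction p with
  | nil => simp
  | cons h p ih =>
    have h1 := hf _ _ h
    have h2 := abs_sub_le (f _) (f _) (f _) |>.trans (add_le_add h1 ih)
    rw [SimpleGraph.Walk.length_cons]
    push_cast
    linarith

theorem dist_map_le {W W' : Type*} {G : SimpleGraph W} {G' : SimpleGraph W'} (hG : G.Connected)
    (φ : G →g G') (x y : W) : G'.dist (φ x) (φ y) ≤ G.dist x y := by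
  obtain ⟨p, hp⟩ := hG.exists_walk_length_eq_dist x y
  rw [← hp, ← SimpleGraph.Walk.length_map φ p]
  exact SimpleGraph.dist_le _

/-- A potential which is invariant under the stars and varies by at most one along edges bounds
distances in the extension graph from below. -/
theorem StarAction.abs_sub_sub_two_le_dist {X : Type*} (S : StarAction Γ X)
    (hconn : (extensionGraph Γ).Connected) {f : V → X → ℤ}
    (hκ : ∀ v x, f v (S.κ v x) = f v x) (hadj : ∀ u v, Γ.Adj u v → ∀ x, |f u x - f v x| ≤ 1)
    (x : X) (u v : V) (g h : ArtinGroup Γ) :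
    |f u (S.hom g x) - f v (S.hom h x)| - 2 ≤
      (extensionGraph Γ).dist (conjVertex Γ u g) (conjVertex Γ v h) := by
  -- The potential may depend on how a vertex is written as a conjugate, but two expressions differ
  -- by at most one because a vertex commutes with itself. Fixing one expression each costs one at
  -- either end, hence the 2.
  choose w q hwq using fun y : ExtVertex Γ => exists_conjVertex_eq y
  have hcomm : ∀ y z : ExtVertex Γ, Commute y.1 z.1 →
      ∀ u g v h, conjVertex Γ u g = y → conjVertex Γ v h = z →
        |f u (S.hom g x) - f v (S.hom h x)| ≤ 1 := by
    rintro _ _ hyz u g v h rfl rfl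
    exact S.abs_sub_le_one hκ hadj hyz x
  have h1 := abs_sub_le_dist hconn (f := fun y => f (w y) (S.hom (q y) x))
    (fun y z hyz => hcomm y z hyz.2 _ _ _ _ (hwq y) (hwq z))
    (conjVertex Γ u g) (conjVertex Γ v h)
  have h2 := hcomm _ _ (Commute.refl _) u g _ _ rfl (hwq (conjVertex Γ u g))
  have h3 := hcomm _ _ (Commute.refl _) v h _ _ rfl (hwq (conjVertex Γ v h))
  simp only [abs_le] at h1 h2 h3
  have h4 : |f u (S.hom g x) - f v (S.hom h x)| ≤
      (extensionGraph Γ).dist (conjVertex Γ u g) (conjVertex Γ v h) + 2 := by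
    rw [abs_le]
    constructor <;> linarith
  linarith

/-- Conjugation does not increase distances, so changing the base vertex alters the displacement by
at most `2 * d x y`, which vanishes after division by `n`. -/
theorem hasTranslationLength_of_bound (hconn : (extensionGraph Γ).Connected) {g : ArtinGroup Γ}
    {τ C : ℝ} (y : ExtVertex Γ)
    (h : ∀ n : ℕ, |((extensionGraph Γ).dist y (conjIso Γ (g ^ n) y) : ℝ) - n * τ| ≤ C) :
    HasTranslationLength Γ g τ := by
  intro x
  set d := (extensionGraph Γ).dist with hd
  have hbound : ∀ n : ℕ, |(d x (conjIso Γ (g ^ n) x) : ℝ) - n * τ| ≤ C + 2 * d x y := by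
    intro n
    have hm : ∀ z z', d (conjIso Γ (g ^ n) z) (conjIso Γ (g ^ n) z') ≤ d z z' :=
      fun z z' => dist_map_le hconn (conjIso Γ (g ^ n)).toHom z z'
    have h1 : d x (conjIso Γ (g ^ n) x) ≤
        d x y + (d y (conjIso Γ (g ^ n) y) + d y x) :=
      hconn.dist_triangle.trans (Nat.add_le_add_left
        (hconn.dist_triangle.trans (Nat.add_le_add_left (hm y x) _)) _)
    have h2 : d y (conjIso Γ (g ^ n) y) ≤
        d y x + (d x (conjIso Γ (g ^ n) x) + d x y) :=
      hconn.dist_triangle.trans (Nat.add_le_add_left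
        (hconn.dist_triangle.trans (Nat.add_le_add_left (hm x y) _)) _)
    have h3 : d y x = d x y := SimpleGraph.dist_comm
    rw [h3] at h1 h2
    have h1' : (d x (conjIso Γ (g ^ n) x) : ℝ) ≤
        d x y + (d y (conjIso Γ (g ^ n) y) + d x y) := by exact_mod_cast h1
    have h2' : (d y (conjIso Γ (g ^ n) y) : ℝ) ≤
        d x y + (d x (conjIso Γ (g ^ n) x) + d x y) := by exact_mod_cast h2
    have h4 := abs_le.mp (h n)
    rw [abs_le]
    constructor <;> linarith
  rw [tendsto_iff_norm_sub_tendsto_zero]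
  refine squeeze_zero' (Eventually.of_forall fun n => norm_nonneg _) ?_
    (tendsto_const_div_atTop_nhds_zero_nat (C + 2 * d x y))
  filter_upwards [eventually_gt_atTop 0] with n hn
  have hn' : (0 : ℝ) < n := Nat.cast_pos.mpr hn
  rw [Real.norm_eq_abs, le_div_iff₀ hn', ← abs_of_pos hn', ← abs_mul, abs_of_pos hn', sub_mul,
    div_mul_cancel₀ _ hn'.ne', mul_comm τ]
  exact hbound n

end ExtensionGraph

/-! ### Syllable length bounded below by exponent sums -/

section SyllableLength

variable {V : Type*} {Γ : SimpleGraph V}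

open Classical in
/-- The exponent sum of a vertex. -/
noncomputable def expSum (Γ : SimpleGraph V) (v : V) : ArtinGroup Γ →* Multiplicative ℤ :=
  lift (fun w => if w = v then Multiplicative.ofAdd 1 else 1) fun _ _ _ => Commute.all _ _

theorem exists_finset_expSum (l : List (ArtinGroup Γ)) (hl : ∀ s ∈ l, IsSyllable Γ s) :
    ∃ A : Finset V, A.card ≤ l.length ∧ ∀ v ∉ A, expSum Γ v l.prod = 1 := by
  classical
  induction l with
  | nil => exact ⟨∅, by simp, by simp⟩
  | cons s l ih =>
    obtain ⟨A, hA, h⟩ := ih fun s hs => hl s (List.mem_cons_of_mem _ hs)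
    obtain ⟨v, m, -, rfl⟩ := hl s List.mem_cons_self
    refine ⟨insert v A, (Finset.card_insert_le _ _).trans (by simpa using hA), fun w hw => ?_⟩
    rw [Finset.mem_insert, not_or] at hw
    rw [List.prod_cons, map_mul, h w hw.2, map_zpow, expSum, lift_gen, if_neg (Ne.symm hw.1)]
    simp

/-- Each syllable affects the exponent sum of one vertex only. The factorization in `hg` keeps
`sInf` from taking its default value 0 on the empty set. -/
theorem card_le_syllableLength (A : Finset V) (g : ArtinGroup Γ)
    (hA : ∀ v ∈ A, expSum Γ v g ≠ 1)
    (hg : ∃ l : List (ArtinGroup Γ), (∀ s ∈ l, IsSyllable Γ s) ∧ l.prod = g) :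
    A.card ≤ syllableLength Γ g := by
  obtain ⟨l, hl, hlg⟩ := hg
  refine le_csInf ⟨_, l, hl, rfl, hlg⟩ ?_
  rintro n ⟨l, hl, rfl, rfl⟩
  obtain ⟨B, hB, h⟩ := exists_finset_expSum l hl
  exact (Finset.card_le_card fun v hv => by_contra fun hv' => hA v hv (h v hv')).trans hB

end SyllableLength

/-! ### The graph and the syllable length of its element -/

section Gam

variable {k : ℕ}

namespace GVertex

instance : Finite (GVertex k) := by
  let f : Fin 4 ⊕ Fin k ⊕ Fin k ⊕ Fin k → GVertex k :=
    Sum.elim ![u, v, t, w] (Sum.elim uLeaf (Sum.elim vLeaf tLeaf))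
  refine Finite.of_surjective f fun x => ?_
  cases x with
  | u => exact ⟨Sum.inl 0, rfl⟩
  | v => exact ⟨Sum.inl 1, rfl⟩
  | t => exact ⟨Sum.inl 2, rfl⟩
  | w => exact ⟨Sum.inl 3, rfl⟩
  | uLeaf i => exact ⟨Sum.inr (Sum.inl i), rfl⟩
  | vLeaf i => exact ⟨Sum.inr (Sum.inr (Sum.inl i)), rfl⟩
  | tLeaf i => exact ⟨Sum.inr (Sum.inr (Sum.inr i)), rfl⟩

end GVertex

open GVertex

theorem GEdge.ne {x y : GVertex k} (h : GEdge k x y) : x ≠ y := by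
  cases h <;> simp

theorem GEdge.adj {x y : GVertex k} (h : GEdge k x y) : (Gam k).Adj x y :=
  (SimpleGraph.fromRel_adj _ _ _).mpr ⟨h.ne, Or.inl h⟩

theorem Gam_connected (hk : 0 < k) : (Gam k).Connected := by
  have hu : ∀ i, (Gam k).Reachable u (uLeaf i) := fun i => (GEdge.u_leaf i).adj.reachable
  have hv : ∀ i, (Gam k).Reachable u (vLeaf i) :=
    fun i => (hu i).trans (GEdge.u_v i).adj.reachable
  have ht : ∀ i, (Gam k).Reachable u (tLeaf i) :=
    fun i => (hv i).trans (GEdge.v_t i).adj.reachable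
  have key : ∀ x, (Gam k).Reachable u x := by
    intro x
    cases x with
    | u => rfl
    | v => exact (hv ⟨0, hk⟩).trans (GEdge.v_leaf _).adj.symm.reachable
    | t => exact (ht ⟨0, hk⟩).trans (GEdge.t_leaf _).adj.symm.reachable
    | w => exact (hu ⟨0, hk⟩).trans (GEdge.w_u _ rfl).adj.symm.reachable
    | uLeaf i => exact hu i
    | vLeaf i => exact hv i
    | tLeaf i => exact ht i
  have : Nonempty (GVertex k) := ⟨u⟩
  exact SimpleGraph.Connected.mk fun x y => (key x).symm.trans (key y)

theorem syllableLength_tvu : syllableLength (Gam k) (tvu k) = 3 := by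
  classical
  have hsyl : ∀ s ∈ [gen (Gam k) t, gen (Gam k) v, gen (Gam k) u], IsSyllable (Gam k) s := by
    have : ∀ x, IsSyllable (Gam k) (gen (Gam k) x) := fun x => ⟨x, 1, one_ne_zero, by simp⟩
    simp [this]
  have hprod : [gen (Gam k) t, gen (Gam k) v, gen (Gam k) u].prod = tvu k := by
    simp [tvu, mul_assoc]
  refine le_antisymm (Nat.sInf_le ⟨_, hsyl, rfl, hprod⟩) ?_
  refine le_trans (le_of_eq ?_)
    (card_le_syllableLength {t, v, u} (tvu k) ?_ ⟨_, hsyl, hprod⟩)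
  · simp
  · simp [tvu, expSum]

/-! ### The action on the axis, the potential and the lower bound -/

/-- The involution of the integers which exchanges `j` and `j + 1` when `j` is `c` modulo `3`. -/
def flip (c : ℤ) : Equiv.Perm ℤ :=
  Function.Involutive.toPerm
    (fun j => if (j - c) % 3 = 0 then j + 1 else if (j - c) % 3 = 1 then j - 1 else j) (by
    intro j
    dsimp only
    split_ifs <;> omega)

theorem flip_apply (c j : ℤ) :
    flip c j = if (j - c) % 3 = 0 then j + 1 else if (j - c) % 3 = 1 then j - 1 else j := rfl

/-- The vertices `u`, `v`, `t` act on the integers as the reflections along the axis of `t v u`, the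
other vertices trivially. -/
def axisAction (k : ℕ) : StarAction (Gam k) ℤ where
  a
    | u => flip 0
    | v => flip 1
    | t => flip 2
    | _ => 1
  κ
    | u => flip 0
    | uLeaf _ => flip 0
    | v => flip 1
    | vLeaf _ => flip 1
    | t => flip 2
    | tLeaf _ => flip 2
    | w => 1
  κ_κ x j := by
    have h : ∀ c, flip c (flip c j) = j := fun c =>
      (Function.Involutive.toPerm_involutive _) j
    cases x <;> simp [h]
  a_self x := by cases x <;> simp
  a_adj x y h := by
    rcases ((SimpleGraph.fromRel_adj _ _ _).mp h).2 with h | h <;> cases h <;> simp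

/-- The three swaps carry `3 n` successively to `3 n + 1`, `3 n + 2`, `3 n + 3`; `tvu` is not a
translation of all integers. -/
theorem hom_tvu_pow (n : ℕ) : (axisAction k).hom (tvu k ^ n) 0 = 3 * n := by
  induction n with
  | zero => simp
  | succ n ih =>
    have h : ∀ j, (axisAction k).hom (tvu k) j = flip 2 (flip 1 (flip 0 j)) := fun j => by
      rw [tvu, map_mul, map_mul]
      simp only [StarAction.hom, lift_gen]
      rfl
    rw [pow_succ', map_mul, Equiv.Perm.mul_apply, ih, h]
    have h0 : flip 0 (3 * n) = 3 * n + 1 := by rw [flip_apply, if_pos]; omega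
    have h1 : flip 1 (3 * n + 1) = 3 * n + 2 := by rw [flip_apply, if_pos] <;> omega
    have h2 : flip 2 (3 * n + 2) = 3 * n + 3 := by rw [flip_apply, if_pos] <;> omega
    rw [h0, h1, h2]
    push_cast
    ring

/-- The quotient `x / k`, rounded up. -/
def ceilDiv (k : ℕ) (x : ℤ) : ℤ := (x + k - 1) / k

theorem ceilDiv_mono (hk : 0 < k) {x y : ℤ} (h : x ≤ y) : ceilDiv k x ≤ ceilDiv k y :=
  Int.ediv_le_ediv (by omega) (by omega)

theorem ceilDiv_add (hk : 0 < k) (x : ℤ) : ceilDiv k (x + k) = ceilDiv k x + 1 := by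
  have h : x + k + k - 1 = (x + k - 1) + k := by ring
  rw [ceilDiv, h, Int.add_ediv_of_dvd_right (dvd_refl _), Int.ediv_self (by omega), ceilDiv]

theorem le_mul_ceilDiv (hk : 0 < k) (x : ℤ) : x ≤ k * ceilDiv k x := by
  have h1 := Int.emod_add_mul_ediv (x + k - 1) k
  have h2 := Int.emod_lt_of_pos (x + k - 1) (by omega : (0 : ℤ) < k)
  rw [ceilDiv]
  omega

theorem ceilDiv_zero (hk : 0 < k) : ceilDiv k 0 = 0 :=
  Int.ediv_eq_zero_of_lt (by omega) (by omega)

theorem ceilDiv_sub (hk : 0 < k) (x : ℤ) (i : ℕ) (hi : i < k) :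
    ceilDiv k x - 1 ≤ ceilDiv k (x - i) ∧ ceilDiv k (x - i) ≤ ceilDiv k x := by
  constructor
  · have h1 := ceilDiv_add hk (x - k)
    rw [sub_add_cancel] at h1
    have h2 := ceilDiv_mono hk (show x - k ≤ x - i by omega)
    omega
  · exact ceilDiv_mono hk (by omega)

theorem ceilDiv_sub_one (hk : 0 < k) (x : ℤ) :
    ceilDiv k x - 1 ≤ ceilDiv k (x - 1) ∧ ceilDiv k (x - 1) ≤ ceilDiv k x := by
  constructor
  · have h1 := ceilDiv_add hk (x - k)
    rw [sub_add_cancel] at h1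
    have h2 := ceilDiv_mono hk (show x - k ≤ x - 1 by omega)
    omega
  · exact ceilDiv_mono hk (by omega)

/-- The potential of `u` and its leaves. -/
def potU (k : ℕ) (i : ℕ) (j : ℤ) : ℤ :=
  if j % 3 = 2 then j + ceilDiv k (j / 3 - i) else 3 * (j / 3) + ceilDiv k (j / 3 - i)

/-- The potential of `v` and its leaves. -/
def potV (k : ℕ) (i : ℕ) (j : ℤ) : ℤ :=
  if j % 3 = 0 then j + ceilDiv k (j / 3 - 1 - i) else 3 * (j / 3) + 1 + ceilDiv k (j / 3 - i)

/-- The potential of `t` and its leaves. -/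
def potT (k : ℕ) (i : ℕ) (j : ℤ) : ℤ :=
  if j % 3 = 0 then j - 1 + ceilDiv k (j / 3 - 1 - i)
  else if j % 3 = 1 then j - 1 + ceilDiv k (j / 3 - i) else j + ceilDiv k (j / 3 - i)

/-- The potential of `w`. -/
def potW (k : ℕ) (j : ℤ) : ℤ :=
  if j % 3 = 2 then j - 1 + ceilDiv k (j / 3 + 1) else j - 1 + ceilDiv k (j / 3)

/-- The distance from the negative end of the axis of `t v u`, up to an additive constant. -/
def potential (k : ℕ) : GVertex k → ℤ → ℤ
  | u => potU k 0
  | uLeaf i => potU k i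
  | v => potV k 0
  | vLeaf i => potV k i
  | t => potT k 0
  | tLeaf i => potT k i
  | w => potW k

theorem int_cases_mod_three (j : ℤ) : ∃ m, j = 3 * m ∨ j = 3 * m + 1 ∨ j = 3 * m + 2 :=
  ⟨j / 3, by omega⟩

theorem mod_div_three (m : ℤ) : (3 * m) % 3 = 0 ∧ (3 * m) / 3 = m ∧ (3 * m + 1) % 3 = 1 ∧
    (3 * m + 1) / 3 = m ∧ (3 * m + 2) % 3 = 2 ∧ (3 * m + 2) / 3 = m := by
  omega

theorem potU_flip (i : ℕ) (j : ℤ) : potU k i (flip 0 j) = potU k i j := by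
  obtain ⟨m, rfl | rfl | rfl⟩ := int_cases_mod_three j
  all_goals
    obtain ⟨h1, h2, h3, h4, h5, h6⟩ := mod_div_three m
    simp [flip_apply, potU, h1, h2, h3, h4, h5, h6]

theorem potV_flip (i : ℕ) (j : ℤ) : potV k i (flip 1 j) = potV k i j := by
  obtain ⟨m, rfl | rfl | rfl⟩ := int_cases_mod_three j
  · rw [flip_apply, if_neg (by omega), if_neg (by omega)]
  · rw [flip_apply, if_pos (by omega)]
    have h1 : (3 * m + 1 + 1) / 3 = m := by omega
    have h2 : (3 * m + 1) / 3 = m := by omega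
    rw [potV, if_neg (by omega), potV, if_neg (by omega), h1, h2]
  · rw [flip_apply, if_neg (by omega), if_pos (by omega)]
    have h1 : (3 * m + 2 - 1) / 3 = m := by omega
    have h2 : (3 * m + 2) / 3 = m := by omega
    rw [potV, if_neg (by omega), potV, if_neg (by omega), h1, h2]

theorem potT_flip (i : ℕ) (j : ℤ) : potT k i (flip 2 j) = potT k i j := by
  have key : ∀ m : ℤ, potT k i (3 * m + 2) = potT k i (3 * (m + 1)) := by
    intro m
    have h1 : (3 * (m + 1)) / 3 - 1 = m := by omega
    have h2 : (3 * m + 2) / 3 = m := by omega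
    rw [potT, if_neg (by omega), if_neg (by omega), potT, if_pos (by omega), h1, h2]
    ring
  obtain ⟨m, rfl | rfl | rfl⟩ := int_cases_mod_three j
  · rw [flip_apply, if_neg (by omega), if_pos (by omega)]
    have h := key (m - 1)
    rw [sub_add_cancel] at h
    rw [← h]
    congr 1
    ring
  · rw [flip_apply, if_neg (by omega), if_neg (by omega)]
  · rw [flip_apply, if_pos (by omega), key]
    congr 1
    ring

theorem potential_κ (x : GVertex k) (j : ℤ) :
    potential k x ((axisAction k).κ x j) = potential k x j := by
  cases x with
  | u => exact potU_flip 0 j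
  | uLeaf i => exact potU_flip i j
  | v => exact potV_flip 0 j
  | vLeaf i => exact potV_flip i j
  | t => exact potT_flip 0 j
  | tLeaf i => exact potT_flip i j
  | w => rfl

theorem abs_potential_sub_le_of_edge (hk : 0 < k) {x y : GVertex k} (h : GEdge k x y) (j : ℤ) :
    |potential k x j - potential k y j| ≤ 1 := by
  obtain ⟨m, hm⟩ := int_cases_mod_three j
  obtain ⟨h1, h2, h3, h4, h5, h6⟩ := mod_div_three m
  cases h with
  | u_leaf i =>
    have := ceilDiv_sub hk m i i.2
    rcases hm with rfl | rfl | rfl <;> rw [abs_le] <;>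
      simp [potential, potU, *] <;> omega
  | v_leaf i =>
    have := ceilDiv_sub hk m i i.2
    have := ceilDiv_sub hk (m - 1) i i.2
    rcases hm with rfl | rfl | rfl <;> rw [abs_le] <;>
      simp [potential, potV, *] <;> omega
  | t_leaf i =>
    have := ceilDiv_sub hk m i i.2
    have := ceilDiv_sub hk (m - 1) i i.2
    rcases hm with rfl | rfl | rfl <;> rw [abs_le] <;>
      simp [potential, potT, *] <;> omega
  | u_v i =>
    have := ceilDiv_sub_one hk (m - i)
    rw [sub_right_comm] at this
    rcases hm with rfl | rfl | rfl <;> rw [abs_le] <;>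
      simp [potential, potU, potV, *] <;> omega
  | v_t i =>
    rcases hm with rfl | rfl | rfl <;> rw [abs_le] <;>
      simp [potential, potV, potT, *]
  | t_u i i' hi =>
    have := ceilDiv_sub_one hk (m - i)
    -- At `3 * m`, the `t` block belongs to period `m - 1`: passing to the next leaf and the next
    -- period leaves the argument of `ceilDiv` unchanged.
    have h7 : m - (i' : ℕ) = m - i - 1 := by omega
    have h8 : m - 1 - (i : ℕ) = m - i - 1 := by omega
    rcases hm with rfl | rfl | rfl <;> rw [abs_le] <;>
      simp [potential, potU, potT, h1, h2, h3, h4, h5, h6, h7, h8] <;> omega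
  | t_w i hi =>
    have := ceilDiv_sub_one hk (m + 1)
    have := ceilDiv_add hk (m - k)
    have := ceilDiv_add hk (m + 1 - k)
    -- For the last leaf `i = k - 1`, so the arguments shift by exactly `k` and `ceilDiv` by exactly
    -- one: this is the extra edge of the detour.
    have h7 : m - (i : ℕ) = m + 1 - k := by omega
    have h8 : m - 1 - (i : ℕ) = m - k := by omega
    simp only [sub_add_cancel, add_sub_cancel_right] at *
    rcases hm with rfl | rfl | rfl <;> rw [abs_le] <;>
      simp [potential, potW, potT, h1, h2, h3, h4, h5, h6, h7, h8] <;> omega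
  | w_u i hi =>
    have := ceilDiv_sub_one hk (m + 1)
    simp only [add_sub_cancel_right] at *
    rcases hm with rfl | rfl | rfl <;> rw [abs_le] <;>
      simp [potential, potW, potU, *] <;> omega

theorem abs_potential_sub_le (hk : 0 < k) (x y : GVertex k) (h : (Gam k).Adj x y) (j : ℤ) :
    |potential k x j - potential k y j| ≤ 1 := by
  rcases ((SimpleGraph.fromRel_adj _ _ _).mp h).2 with h | h
  · exact abs_potential_sub_le_of_edge hk h j
  · rw [abs_sub_comm]
    exact abs_potential_sub_le_of_edge hk h j

theorem le_dist_tvu_pow (hk : 0 < k) (n : ℕ) :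
    n * (3 + 1 / (k : ℝ)) - 2 ≤ ((extensionGraph (Gam k)).dist
      (conjVertex (Gam k) (uLeaf ⟨0, hk⟩) 1)
      (conjVertex (Gam k) (uLeaf ⟨0, hk⟩) (tvu k ^ n)) : ℝ) := by
  have h := (axisAction k).abs_sub_sub_two_le_dist
    (extensionGraph_connected (Gam_connected hk)) potential_κ (abs_potential_sub_le hk) 0
    (uLeaf ⟨0, hk⟩) (uLeaf ⟨0, hk⟩) 1 (tvu k ^ n)
  have h0 : potential k (uLeaf ⟨0, hk⟩) 0 = 0 := by simp [potential, potU, ceilDiv_zero hk]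
  have h1 : potential k (uLeaf ⟨0, hk⟩) (3 * n) = 3 * n + ceilDiv k n := by
    simp [potential, potU]
  rw [hom_tvu_pow, map_one, Equiv.Perm.one_apply, h0, h1, zero_sub, abs_neg] at h
  have h2 := (sub_le_sub_right (le_abs_self _) _).trans h
  have h3 : (3 * n + ceilDiv k n - 2 : ℝ) ≤ ((extensionGraph (Gam k)).dist
      (conjVertex (Gam k) (uLeaf ⟨0, hk⟩) 1)
      (conjVertex (Gam k) (uLeaf ⟨0, hk⟩) (tvu k ^ n)) : ℝ) := by exact_mod_cast h2
  have h4 : (n : ℝ) ≤ k * ceilDiv k n := by exact_mod_cast le_mul_ceilDiv hk n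
  have h5 : (n : ℝ) / k ≤ ceilDiv k n := by
    rwa [div_le_iff₀' (Nat.cast_pos.mpr hk)]
  have h6 : (n : ℝ) * (3 + 1 / k) = 3 * n + n / k := by ring
  linarith

/-! ### The explicit path and the upper bound -/

theorem dist_uLeaf_tLeaf_le (hk : 0 < k) (i : Fin k) (g : ArtinGroup (Gam k)) :
    (extensionGraph (Gam k)).dist (conjVertex (Gam k) (uLeaf i) g)
      (conjVertex (Gam k) (tLeaf i) (tvu k * g)) ≤ 2 := by
  have hconn := extensionGraph_connected (Gam_connected hk)
  have h1 := dist_conjVertex_le_one (GEdge.u_v i).adj (gen (Gam k) u * g)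
  have h2 := dist_conjVertex_le_one (GEdge.v_t i).adj (gen (Gam k) v * (gen (Gam k) u * g))
  rw [conjVertex_mul (commute_gen (GEdge.u_leaf i).adj).symm] at h1
  rw [conjVertex_mul (commute_gen (GEdge.v_leaf i).adj).symm,
    ← conjVertex_mul (commute_gen (GEdge.t_leaf i).adj).symm] at h2
  rw [tvu, mul_assoc, mul_assoc]
  exact hconn.dist_triangle.trans (Nat.add_le_add h1 h2)

/-- Here `q` counts the passages through `w`, each made when the leaf index wraps from `k - 1` to 0.
-/
theorem exists_dist_uLeaf_le (hk : 0 < k) (n : ℕ) : ∃ (q : ℕ) (i : Fin k), n = k * q + i ∧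
    (extensionGraph (Gam k)).dist (conjVertex (Gam k) (uLeaf ⟨0, hk⟩) 1)
      (conjVertex (Gam k) (uLeaf i) (tvu k ^ n)) ≤ 3 * n + q := by
  have hconn := extensionGraph_connected (Gam_connected hk)
  induction n with
  | zero => exact ⟨0, ⟨0, hk⟩, by simp, by simp⟩
  | succ n ih =>
    obtain ⟨q, i, hn, hd⟩ := ih
    have h1 := Nat.add_le_add hd (dist_uLeaf_tLeaf_le hk i (tvu k ^ n))
    rw [← pow_succ'] at h1
    have h2 := hconn.dist_triangle.trans h1
    by_cases hi : (i : ℕ) + 1 < k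
    · refine ⟨q, ⟨i + 1, hi⟩, by simp only; omega, ?_⟩
      have h3 := hconn.dist_triangle.trans (Nat.add_le_add h2
        (dist_conjVertex_le_one (GEdge.t_u i ⟨i + 1, hi⟩ rfl).adj (tvu k ^ (n + 1))))
      omega
    · have hi' : (i : ℕ) + 1 = k := by omega
      refine ⟨q + 1, ⟨0, hk⟩, by simp only [mul_add]; omega, ?_⟩
      have h3 := hconn.dist_triangle.trans (Nat.add_le_add h2
        (dist_conjVertex_le_one (GEdge.t_w i hi').adj (tvu k ^ (n + 1))))
      have h4 := hconn.dist_triangle.trans (Nat.add_le_add h3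
        (dist_conjVertex_le_one (GEdge.w_u ⟨0, hk⟩ rfl).adj (tvu k ^ (n + 1))))
      omega

theorem dist_tvu_pow_le (hk : 0 < k) (n : ℕ) :
    ((extensionGraph (Gam k)).dist (conjVertex (Gam k) (uLeaf ⟨0, hk⟩) 1)
      (conjVertex (Gam k) (uLeaf ⟨0, hk⟩) (tvu k ^ n)) : ℝ) ≤ n * (3 + 1 / (k : ℝ)) + 2 := by
  have hconn := extensionGraph_connected (Gam_connected hk)
  obtain ⟨q, i, hn, hd⟩ := exists_dist_uLeaf_le hk n
  -- Returning from leaf `i` to leaf 0 through the center `u` costs the additive 2.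
  have h1 := hconn.dist_triangle.trans (Nat.add_le_add hd
    (dist_conjVertex_le_one (GEdge.u_leaf i).adj.symm (tvu k ^ n)))
  have h2 := hconn.dist_triangle.trans (Nat.add_le_add h1
    (dist_conjVertex_le_one (GEdge.u_leaf ⟨0, hk⟩).adj (tvu k ^ n)))
  have h3 : ((extensionGraph (Gam k)).dist (conjVertex (Gam k) (uLeaf ⟨0, hk⟩) 1)
      (conjVertex (Gam k) (uLeaf ⟨0, hk⟩) (tvu k ^ n)) : ℝ) ≤ 3 * n + q + 1 + 1 := by
    exact_mod_cast h2
  have h4 : k * q ≤ n := by omega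
  have h5 : (q : ℝ) ≤ n / k := by
    rw [le_div_iff₀' (Nat.cast_pos.mpr hk)]
    exact_mod_cast h4
  have h6 : (n : ℝ) * (3 + 1 / k) = 3 * n + n / k := by ring
  linarith

theorem hasTranslationLength_tvu (hk : 0 < k) :
    HasTranslationLength (Gam k) (tvu k) (3 + 1 / (k : ℝ)) := by
  refine hasTranslationLength_of_bound (extensionGraph_connected (Gam_connected hk)) (C := 2)
    (conjVertex (Gam k) (uLeaf ⟨0, hk⟩) 1) fun n => ?_
  rw [conjIso_conjVertex, one_mul, abs_le]
  have h1 := le_dist_tvu_pow hk n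
  have h2 := dist_tvu_pow_le hk n
  constructor <;> linarith

theorem den_three_add_one_div (hk : 0 < k) : (3 + 1 / (k : ℚ)).den = k := by
  rw [one_div, Rat.ofNat_add_den, Rat.inv_natCast_den_of_pos hk]

end Gam

end RAAG

theorem mainTheorem8 (k : ℕ) (hk : 2 ≤ k) :
    Finite (RAAG.GVertex k) ∧
    (RAAG.Gam k).Connected ∧
    RAAG.syllableLength (RAAG.Gam k) (RAAG.tvu k) = 3 ∧
    (RAAG.extensionGraph (RAAG.Gam k)).Connected ∧
    RAAG.HasTranslationLength (RAAG.Gam k) (RAAG.tvu k) (3 + 1 / (k : ℝ)) ∧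
    (3 + 1 / (k : ℚ)).den = k := by
  have hk' : 0 < k := by omega
  exact ⟨inferInstance, RAAG.Gam_connected hk', RAAG.syllableLength_tvu,
    RAAG.extensionGraph_connected (RAAG.Gam_connected hk'), RAAG.hasTranslationLength_tvu hk',
    RAAG.den_three_add_one_div hk'⟩
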